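/- Let $X$ be a complete CAT($-1$) space, that is, a complete geodesic metric space in which every geodesic triangle is at most as thick as its comparison triangle in the hyperbolic plane of curvature $-1$. Let $\partial X$ be its boundary at infinity, the set of geodesic rays $[0,\infty)\to X$ modulo the relation of staying at bounded distance from each other; every isometry of $X$ acts on $X\cup\partial X$. Let $G$ be a topological group and let $\rho\colon G\to \mathrm{Isom}(X)$ be a representation that is orbitally continuous, i.e. such that $g\mapsto\rho(g)x$ is continuous for every $x\in X$ (if $G$ carries the discrete topology, this is no restriction). Then $\rho$ is non-elementary, i.e. $G$ has no finite orbit in $X\cup\partial X$, if and only if $G$ fixes no point of $X\cup\partial X$ and preserves no geodesic, i.e. there is no isometric embedding $\gamma\colon\mathbb{R}\to X$ with $\rho(g)(\gamma(\mathbb{R}))=\gamma(\mathbb{R})$ for all $g\in G$. -/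

import Mathlib

open scoped NNReal UpperHalfPlane

/-- `γ`, restricted to `[0, d(x, y)]`, is a geodesic segment from `x` to `y`, parametrized by
arc length. Values of `γ` outside this interval are irrelevant. -/
def IsGeodesicSegment {X : Type*} [MetricSpace X] (γ : ℝ → X) (x y : X) : Prop :=
  γ 0 = x ∧ γ (dist x y) = y ∧
    ∀ s ∈ Set.Icc 0 (dist x y), ∀ t ∈ Set.Icc 0 (dist x y), dist (γ s) (γ t) = |s - t|

/-- A CAT(-1) space: a geodesic metric space all of whose geodesic triangles are at most as thick
as their comparison triangles in the hyperbolic plane (of curvature `-1`), here the upper half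
plane `ℍ` with its Poincaré metric.

In `comparison`, `α` and `β` are two sides of a geodesic triangle with vertices `p`, `q`, `r`, with
the common vertex `p`; `α s` and `β t` are points on them; `p'`, `q'`, `r'` is a
comparison triangle, and `x'`, `y'` are the comparison points of `α s` and `β t`, that is, the
points of the hyperbolic segments `[p', q']` and `[p', r']` at distance `s` and `t` from `p'`.
(For two points on the same side the comparison inequality is an equality.) -/
structure IsCATNegOne (X : Type*) [MetricSpace X] : Prop where
  exists_geodesic : ∀ x y : X, ∃ γ : ℝ → X, IsGeodesicSegment γ x y
  comparison : ∀ (p q r : X) (α β : ℝ → X),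
    IsGeodesicSegment α p q → IsGeodesicSegment β p r →
    ∀ p' q' r' : ℍ, dist p' q' = dist p q → dist p' r' = dist p r → dist q' r' = dist q r →
    ∀ s ∈ Set.Icc 0 (dist p q), ∀ t ∈ Set.Icc 0 (dist p r),
    ∀ x' y' : ℍ,
      dist p' x' = s → dist x' q' = dist p q - s →
      dist p' y' = t → dist y' r' = dist p r - t →
      dist (α s) (β t) ≤ dist x' y'

/-- A geodesic ray: an isometric embedding of `[0, ∞)`. -/
def GeodesicRay (X : Type*) [MetricSpace X] : Type _ :=
  {σ : ℝ≥0 → X // Isometry σ}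

/-- Two geodesic rays are asymptotic if they stay at bounded distance from each other. -/
def GeodesicRay.Asymptotic {X : Type*} [MetricSpace X] (σ τ : GeodesicRay X) : Prop :=
  ∃ K : ℝ, ∀ t : ℝ≥0, dist (σ.1 t) (τ.1 t) ≤ K

/-- Being asymptotic is an equivalence relation on the set of geodesic rays. -/
def GeodesicRay.setoid (X : Type*) [MetricSpace X] : Setoid (GeodesicRay X) where
  r := GeodesicRay.Asymptotic
  iseqv :=
    { refl := fun σ => ⟨0, fun t => by simp⟩
      symm := fun ⟨K, h⟩ => ⟨K, fun t => by rw [dist_comm]; exact h t⟩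
      trans := fun ⟨K, h⟩ ⟨L, h'⟩ =>
        ⟨K + L, fun t => (dist_triangle _ _ _).trans (add_le_add (h t) (h' t))⟩ }

/-- The boundary at infinity `∂X`: the set of classes of asymptotic geodesic rays. -/
def BoundaryAtInfinity (X : Type*) [MetricSpace X] : Type _ :=
  Quotient (GeodesicRay.setoid X)

/-- The image of a geodesic ray under an isometry. -/
def GeodesicRay.map {X : Type*} [MetricSpace X] (φ : X ≃ᵢ X) (σ : GeodesicRay X) :
    GeodesicRay X :=
  ⟨fun t => φ (σ.1 t), φ.isometry.comp σ.2⟩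

/-- The map of `∂X` induced by an isometry of `X`. -/
def BoundaryAtInfinity.map {X : Type*} [MetricSpace X] (φ : X ≃ᵢ X) :
    BoundaryAtInfinity X → BoundaryAtInfinity X :=
  Quotient.map' (s₁ := GeodesicRay.setoid X) (s₂ := GeodesicRay.setoid X) (GeodesicRay.map φ)
    (fun _ _ ⟨K, h⟩ => ⟨K, fun t => (φ.dist_eq _ _).trans_le (h t)⟩)

/-- The map of the disjoint union `X ∪ ∂X` induced by an isometry of `X`. -/
def bordificationMap {X : Type*} [MetricSpace X] (φ : X ≃ᵢ X) :
    X ⊕ BoundaryAtInfinity X → X ⊕ BoundaryAtInfinity X :=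
  Sum.map φ (BoundaryAtInfinity.map φ)

/-- A representation by isometries is orbitally continuous if all its orbit maps on `X` are
continuous. -/
def OrbitallyContinuous {G X : Type*} [Group G] [TopologicalSpace G] [MetricSpace X]
    (ρ : G →* (X ≃ᵢ X)) : Prop :=
  ∀ x : X, Continuous fun g : G => ρ g x

/-- A representation by isometries is non-elementary if it has no finite orbit in `X ∪ ∂X`. -/
def NonElementary {G X : Type*} [Group G] [MetricSpace X] (ρ : G →* (X ≃ᵢ X)) : Prop :=
  ∀ z : X ⊕ BoundaryAtInfinity X, ¬ (Set.range fun g : G => bordificationMap (ρ g) z).Finite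

/-- The representation fixes a point of `X ∪ ∂X`. -/
def FixesPoint {G X : Type*} [Group G] [MetricSpace X] (ρ : G →* (X ≃ᵢ X)) : Prop :=
  ∃ z : X ⊕ BoundaryAtInfinity X, ∀ g : G, bordificationMap (ρ g) z = z

/-- The representation preserves (as a set) a geodesic, that is, the image of an isometric
embedding of the real line. -/
def PreservesGeodesic {G X : Type*} [Group G] [MetricSpace X] (ρ : G →* (X ≃ᵢ X)) : Prop :=
  ∃ γ : ℝ → X, Isometry γ ∧ ∀ g : G, ρ g '' Set.range γ = Set.range γ

/-!
The statement reduces to showing that a finite orbit in `X ∪ ∂X` yields a fixed point or an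
invariant geodesic; conversely, the ends of an invariant geodesic form an invariant set.

The comparison axiom enters only through `IsCATNegOne.cosh_dist_mul_sinh_le`: along a geodesic,
`f = cosh ∘ dist r` satisfies `f'' ≥ f`, since equality holds in the hyperbolic plane. Hence `f`
satisfies a midpoint inequality, and so do sums of such functions and the limits
`exp ∘ σ.busemann`, where `σ.busemann` is the Busemann function of a ray `σ`. A continuous function
with this property and a positive lower bound has a unique minimizer in a complete space
(`exists_forall_le_of_midpoint`, `eq_of_forall_le_of_midpoint`). Both kinds of points needed are
obtained as such minimizers.

* A finite orbit in `X` gives a fixed point, the minimizer of the sum of `cosh ∘ dist z` over the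
  points `z` of the orbit (`IsCATNegOne.exists_fixed_of_finite_orbit`).
* Let `σ`, `τ` be non-asymptotic rays. Then `σ.busemann + τ.busemann` is bounded below
  (`IsCATNegOne.bddBelow_busemann_add`), and its minimizers form a geodesic: the point with
  parameter `u` is the minimizer of `exp (u + σ.busemann ·) + exp (-u + τ.busemann ·)`
  (`IsCATNegOne.exists_geodesic_line`).

Busemann functions of asymptotic rays differ by a constant
(`IsCATNegOne.exists_busemann_eq_add`), by a quadrilateral inequality. So an isometry that preserves
a pair of boundary points changes `σ.busemann + τ.busemann` by a constant, which is zero as the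
function has a minimum. Consequently an orbit with two points in the boundary gives an invariant
geodesic. If an isometry fixes three boundary points, it changes their three Busemann functions by
constants whose pairwise sums vanish. Thus the constants vanish and the isometry fixes the geodesics
between these points pointwise. Therefore a finite orbit with at least three points in the boundary
gives a finite orbit in `X`, hence a fixed point.
-/

/-! ### Convexity of `cosh ∘ dist` along geodesics -/

/-- The point `e ^ u * I` of the upper half plane. The map `u ↦ verticalPoint u` parametrizes the
imaginary axis by arc length. -/
noncomputable def verticalPoint (u : ℝ) : ℍ := ⟨⟨0, Real.exp u⟩, Real.exp_pos u⟩

theorem dist_verticalPoint (u v : ℝ) : dist (verticalPoint u) (verticalPoint v) = |u - v| := by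
  rw [UpperHalfPlane.dist_of_re_eq (by rfl)]
  change dist (Real.log (Real.exp u)) (Real.log (Real.exp v)) = _
  rw [Real.log_exp, Real.log_exp, Real.dist_eq]

theorem cosh_dist_verticalPoint (u : ℝ) (w : ℍ) :
    Real.cosh (dist (verticalPoint u) w) =
      ((w.re ^ 2 + w.im ^ 2) * Real.exp (-u) + Real.exp u) / (2 * w.im) := by
  rw [UpperHalfPlane.cosh_dist']
  have hu := Real.exp_pos u
  have hw := w.im_pos
  change ((0 - w.re) ^ 2 + (Real.exp u) ^ 2 + w.im ^ 2) / (2 * Real.exp u * w.im) = _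
  rw [Real.exp_neg]
  field_simp
  ring

/-- In the hyperbolic plane, `cosh` of the distance to a point is a solution of `f'' = f` along
every geodesic. -/
theorem cosh_dist_verticalPoint_mul_sinh (a s : ℝ) (w : ℍ) :
    Real.cosh (dist (verticalPoint s) w) * Real.sinh a =
      Real.cosh (dist (verticalPoint 0) w) * Real.sinh (a - s) +
        Real.cosh (dist (verticalPoint a) w) * Real.sinh s := by
  have hw := w.im_pos
  simp only [cosh_dist_verticalPoint]
  field_simp
  rw [Real.sinh_sub, ← Real.cosh_sub_sinh s, ← Real.cosh_sub_sinh a, ← Real.cosh_add_sinh s,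
    ← Real.cosh_add_sinh a]
  simp only [neg_zero, Real.exp_zero]
  ring

/-- Existence of comparison triangles, with one side on the imaginary axis. -/
theorem exists_comparison_vertex {a b c : ℝ} (ha : 0 < a) (hb : 0 ≤ b) (hc : 0 ≤ c)
    (h₁ : a ≤ b + c) (h₂ : b ≤ a + c) (h₃ : c ≤ a + b) :
    ∃ w : ℍ, dist (verticalPoint 0) w = b ∧ dist (verticalPoint a) w = c := by
  have hsa : 0 < Real.sinh a := Real.sinh_pos_iff.2 ha
  have hsa' : Real.exp (-a) = Real.cosh a - Real.sinh a := (Real.cosh_sub_sinh a).symm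
  have hca : Real.exp a = Real.cosh a + Real.sinh a := (Real.cosh_add_sinh a).symm
  have hsb' : Real.exp (-b) = Real.cosh b - Real.sinh b := (Real.cosh_sub_sinh b).symm
  have hcb : Real.exp b = Real.cosh b + Real.sinh b := (Real.cosh_add_sinh b).symm
  -- `D` is chosen so that `sinh a / D` is the imaginary part of the vertex
  set D := Real.cosh c - Real.exp (-a) * Real.cosh b with hD
  have hD₁ : Real.exp (-b) * Real.sinh a ≤ D := by
    have : Real.cosh (b - a) ≤ Real.cosh c := by
      rw [Real.cosh_le_cosh, abs_of_nonneg hc]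
      exact abs_le.2 ⟨by linarith, by linarith⟩
    rw [Real.cosh_sub] at this
    rw [hD, hsb', hsa']
    nlinarith
  have hD₂ : D ≤ Real.exp b * Real.sinh a := by
    have : Real.cosh c ≤ Real.cosh (a + b) := by
      rw [Real.cosh_le_cosh, abs_of_nonneg hc]
      exact h₃.trans (le_abs_self _)
    rw [Real.cosh_add] at this
    rw [hD, hcb, hsa']
    nlinarith
  have hDpos : 0 < D := lt_of_lt_of_le (by positivity) hD₁
  set y := Real.sinh a / D with hy
  have hypos : 0 < y := by positivity
  have hyD : y * D = Real.sinh a := by rw [hy]; field_simp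
  have hy₁ : y ≤ Real.exp b := by
    rw [hy, div_le_iff₀ hDpos]
    calc Real.sinh a = Real.exp b * (Real.exp (-b) * Real.sinh a) := by
          rw [← mul_assoc, ← Real.exp_add]; simp
      _ ≤ _ := by gcongr
  have hy₂ : Real.exp (-b) ≤ y := by
    rw [hy, le_div_iff₀ hDpos]
    calc _ ≤ Real.exp (-b) * (Real.exp b * Real.sinh a) := by gcongr
      _ = Real.sinh a := by rw [← mul_assoc, ← Real.exp_add]; simp
  have hx : 0 ≤ 2 * y * Real.cosh b - 1 - y ^ 2 := by
    have h : Real.exp b * Real.exp (-b) = 1 := by rw [← Real.exp_add]; simp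
    have h' : 2 * Real.cosh b = Real.exp b + Real.exp (-b) := by rw [hcb, hsb']; ring
    nlinarith [mul_nonneg (sub_nonneg.2 hy₁) (sub_nonneg.2 hy₂)]
  have hre : (Real.sqrt (2 * y * Real.cosh b - 1 - y ^ 2)) ^ 2 = 2 * y * Real.cosh b - 1 - y ^ 2 :=
    Real.sq_sqrt hx
  have key : ∀ {d e : ℝ}, 0 ≤ d → 0 ≤ e → Real.cosh d = Real.cosh e → d = e := by
    intro d e hd he h
    have h₁ := Real.cosh_le_cosh.1 h.le
    have h₂ := Real.cosh_le_cosh.1 h.ge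
    rw [abs_of_nonneg hd, abs_of_nonneg he] at h₁ h₂
    exact le_antisymm h₁ h₂
  refine ⟨⟨⟨Real.sqrt (2 * y * Real.cosh b - 1 - y ^ 2), y⟩, hypos⟩,
    key dist_nonneg hb ?_, key dist_nonneg hc ?_⟩
  · rw [cosh_dist_verticalPoint]
    change (((Real.sqrt (2 * y * Real.cosh b - 1 - y ^ 2)) ^ 2 + y ^ 2) * Real.exp (-0) +
      Real.exp 0) / (2 * y) = _
    rw [hre, neg_zero, Real.exp_zero, div_eq_iff (by positivity)]
    ring
  · rw [cosh_dist_verticalPoint]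
    change (((Real.sqrt (2 * y * Real.cosh b - 1 - y ^ 2)) ^ 2 + y ^ 2) * Real.exp (-a) +
      Real.exp a) / (2 * y) = _
    rw [hre, div_eq_iff (by positivity)]
    linear_combination -2 * hyD + hca - hsa' + 2 * y * hD

namespace IsCATNegOne

variable {X : Type*} [MetricSpace X]

/-- Along a geodesic of a CAT(-1) space, `f = cosh ∘ dist r` satisfies `f'' ≥ f`, in integrated
form. This is the only consequence of the comparison axiom that is needed. -/
theorem cosh_dist_mul_sinh_le (hX : IsCATNegOne X) {p q : X} (r : X) {α : ℝ → X}
    (hα : IsGeodesicSegment α p q) {s : ℝ} (hs : s ∈ Set.Icc 0 (dist p q)) :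
    Real.cosh (dist r (α s)) * Real.sinh (dist p q) ≤
      Real.cosh (dist r p) * Real.sinh (dist p q - s) +
        Real.cosh (dist r q) * Real.sinh s := by
  obtain ⟨hs₀, hs₁⟩ := hs
  rcases (dist_nonneg (x := p) (y := q)).eq_or_lt with h | h
  · have : s = 0 := le_antisymm (by linarith) hs₀
    simp [← h, this]
  obtain ⟨β, hβ⟩ := hX.exists_geodesic p r
  obtain ⟨w, hw₁, hw₂⟩ := exists_comparison_vertex h (dist_nonneg (x := p) (y := r))
    (dist_nonneg (x := q) (y := r)) (by rw [dist_comm q r]; exact dist_triangle _ _ _)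
    (dist_triangle _ _ _) (by rw [dist_comm p q]; exact dist_triangle _ _ _)
  have hle := hX.comparison p q r α β hα hβ (verticalPoint 0) (verticalPoint (dist p q)) w
    (by rw [dist_verticalPoint, zero_sub, abs_neg, abs_of_pos h]) hw₁ hw₂ s ⟨hs₀, hs₁⟩ (dist p r)
    ⟨dist_nonneg, le_rfl⟩ (verticalPoint s) w
    (by rw [dist_verticalPoint, zero_sub, abs_neg, abs_of_nonneg hs₀])
    (by rw [dist_verticalPoint, abs_sub_comm, abs_of_nonneg (by linarith)]) hw₁ (by simp)
  rw [hβ.2.1, dist_comm] at hle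
  rw [dist_comm r p, dist_comm r q, ← hw₁, ← hw₂, ← cosh_dist_verticalPoint_mul_sinh]
  refine mul_le_mul_of_nonneg_right ?_ (Real.sinh_pos_iff.2 h).le
  exact Real.cosh_le_cosh.2 (by rwa [abs_of_nonneg dist_nonneg, abs_of_nonneg dist_nonneg])

theorem exists_midpoint (hX : IsCATNegOne X) (x y : X) :
    ∃ m, ∀ r, Real.cosh (dist r m) * Real.cosh (dist x y / 2) ≤
      (Real.cosh (dist r x) + Real.cosh (dist r y)) / 2 := by
  obtain ⟨α, hα⟩ := hX.exists_geodesic x y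
  refine ⟨α (dist x y / 2), fun r => ?_⟩
  rcases (dist_nonneg (x := x) (y := y)).eq_or_lt with h | h
  · obtain rfl := dist_eq_zero.1 h.symm
    simp [hα.1]
  have hs := Real.sinh_pos_iff.2 (half_pos h)
  have := hX.cosh_dist_mul_sinh_le r hα (s := dist x y / 2) ⟨by linarith, by linarith⟩
  rw [sub_half] at this
  have h₂ : Real.sinh (dist x y) = 2 * Real.sinh (dist x y / 2) * Real.cosh (dist x y / 2) := by
    rw [← Real.sinh_two_mul, mul_div_cancel₀ _ (two_ne_zero' ℝ)]
  rw [h₂] at this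
  refine le_of_mul_le_mul_right ?_ hs
  linarith

/-- A quadrilateral inequality: the diagonals are bounded in terms of the sides. -/
theorem cosh_mul_cosh_le (hX : IsCATNegOne X) (x y z w : X) :
    4 * (Real.cosh (dist x z / 2) * Real.cosh (dist y w / 2)) ≤
      Real.cosh (dist x y) + Real.cosh (dist y z) + Real.cosh (dist z w) +
        Real.cosh (dist w x) := by
  obtain ⟨m, hm⟩ := hX.exists_midpoint x z
  have hy := hm y
  have hw := hm w
  rw [dist_comm y x] at hy
  rw [dist_comm w z] at hw
  have h : 2 * Real.cosh (dist y w / 2) ≤ Real.cosh (dist y m) + Real.cosh (dist w m) := by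
    have h₁ : Real.cosh (dist y w / 2) ≤ Real.cosh ((dist y m + dist w m) / 2) := by
      apply Real.cosh_le_cosh.2
      rw [abs_of_nonneg (by positivity), abs_of_nonneg (by positivity)]
      linarith [dist_triangle_right y w m]
    have h₂ : Real.cosh (dist y m) + Real.cosh (dist w m) =
        2 * (Real.cosh ((dist y m + dist w m) / 2) * Real.cosh ((dist y m - dist w m) / 2)) := by
      have h₃ := Real.cosh_add ((dist y m + dist w m) / 2) ((dist y m - dist w m) / 2)
      have h₄ := Real.cosh_sub ((dist y m + dist w m) / 2) ((dist y m - dist w m) / 2)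
      ring_nf at h₃ h₄ ⊢
      linarith
    rw [h₂]
    nlinarith [Real.one_le_cosh ((dist y m - dist w m) / 2),
      Real.cosh_pos ((dist y m + dist w m) / 2)]
  nlinarith [Real.cosh_pos (dist x z / 2)]

end IsCATNegOne

/-! ### Minimizers of strongly convex functions, and fixed points -/

/-- If the values of a positive continuous function at the midpoints of pairs of points are
smaller than the average by a factor that depends on the distance, then minimizing sequences are
Cauchy. -/
theorem exists_forall_le_of_midpoint {X : Type*} [MetricSpace X] [CompleteSpace X] [Nonempty X]
    {F : X → ℝ} (hF : Continuous F) {δ : ℝ} (hδ : 0 < δ) (hle : ∀ x, δ ≤ F x)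
    (hmid : ∀ x y, ∃ m, F m * Real.cosh (dist x y / 2) ≤ (F x + F y) / 2) :
    ∃ p, ∀ x, F p ≤ F x := by
  have hbdd : BddBelow (Set.range F) := ⟨δ, by rintro _ ⟨x, rfl⟩; exact hle x⟩
  set I := ⨅ x, F x with hI
  have hIle : ∀ x, I ≤ F x := fun x => ciInf_le hbdd x
  have hIpos : 0 < I := hδ.trans_le (le_ciInf hle)
  have hex : ∀ n : ℕ, ∃ x, F x < I + 1 / (n + 1) := fun n =>
    exists_lt_of_ciInf_lt (lt_add_of_pos_right _ Nat.one_div_pos_of_nat)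
  choose u hu using hex
  have hcauchy : CauchySeq u := by
    rw [Metric.cauchySeq_iff']
    intro ε hε
    have hε' : 1 < Real.cosh (ε / 2) := Real.one_lt_cosh.2 (by positivity)
    obtain ⟨N, hN⟩ := exists_nat_one_div_lt (mul_pos hIpos (sub_pos.2 hε'))
    refine ⟨N, fun n hn => ?_⟩
    obtain ⟨m, hm⟩ := hmid (u n) (u N)
    have h₁ : F (u n) < I + 1 / (N + 1) := (hu n).trans_le (by
      have := Nat.one_div_le_one_div (α := ℝ) hn
      linarith)
    have h₂ := hu N
    have h₃ : I * Real.cosh (dist (u n) (u N) / 2) < I * Real.cosh (ε / 2) :=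
      calc _ ≤ F m * Real.cosh (dist (u n) (u N) / 2) :=
            mul_le_mul_of_nonneg_right (hIle m) (Real.cosh_pos _).le
        _ < _ := by linarith
    have h₄ := Real.cosh_lt_cosh.1 (lt_of_mul_lt_mul_left h₃ hIpos.le)
    rw [abs_of_nonneg (by positivity), abs_of_pos (by positivity)] at h₄
    linarith
  obtain ⟨p, hp⟩ := cauchySeq_tendsto_of_complete hcauchy
  refine ⟨p, fun x => le_trans ?_ (hIle x)⟩
  have h₁ := (hF.tendsto p).comp hp
  have h₂ : Filter.Tendsto (fun n : ℕ => I + 1 / ((n : ℝ) + 1)) Filter.atTop (nhds (I + 0)) :=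
    tendsto_const_nhds.add tendsto_one_div_add_atTop_nhds_zero_nat
  rw [add_zero] at h₂
  exact le_of_tendsto_of_tendsto' h₁ h₂ fun n => (hu n).le

theorem eq_of_forall_le_of_midpoint {X : Type*} [MetricSpace X] {F : X → ℝ} (hpos : ∀ x, 0 < F x)
    (hmid : ∀ x y, ∃ m, F m * Real.cosh (dist x y / 2) ≤ (F x + F y) / 2) {p q : X}
    (hp : ∀ x, F p ≤ F x) (hq : ∀ x, F q ≤ F x) : p = q := by
  obtain ⟨m, hm⟩ := hmid p q
  by_contra hne
  have h₁ : 1 < Real.cosh (dist p q / 2) := Real.one_lt_cosh.2 (by simpa using hne)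
  nlinarith [hp m, hq p, hq m, hpos m]

/-- A finite orbit yields a fixed point: the unique minimizer of the sum of the functions
`cosh ∘ dist z`, over the points `z` of the orbit. -/
theorem IsCATNegOne.exists_fixed_of_finite_orbit {X : Type*} [MetricSpace X] [CompleteSpace X]
    (hX : IsCATNegOne X) {G : Type*} [Group G] (ρ : G →* (X ≃ᵢ X)) {p : X}
    (hfin : (Set.range fun g => ρ g p).Finite) : ∃ q : X, ∀ g, ρ g q = q := by
  classical
  set S := hfin.toFinset with hS
  have hmem : ∀ {z}, z ∈ S ↔ ∃ g, ρ g p = z := by simp [hS]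
  have hpS : p ∈ S := hmem.2 ⟨1, by simp⟩
  set F : X → ℝ := fun x => ∑ z ∈ S, Real.cosh (dist z x) with hF
  have hcont : Continuous F := by fun_prop
  have hle : ∀ x, 1 ≤ F x := fun x =>
    (Real.one_le_cosh (dist p x)).trans
      (Finset.single_le_sum (f := fun z => Real.cosh (dist z x))
        (fun z _ => (Real.cosh_pos _).le) hpS)
  have hmid : ∀ x y, ∃ m, F m * Real.cosh (dist x y / 2) ≤ (F x + F y) / 2 := by
    intro x y
    obtain ⟨m, hm⟩ := hX.exists_midpoint x y
    refine ⟨m, ?_⟩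
    rw [hF, Finset.sum_mul, ← Finset.sum_add_distrib, Finset.sum_div]
    exact Finset.sum_le_sum fun z _ => hm z
  have hinv : ∀ g x, F (ρ g x) = F x := by
    intro g x
    refine Finset.sum_bij' (fun z _ => ρ g⁻¹ z) (fun z _ => ρ g z) ?_ ?_ ?_ ?_ ?_
    · rintro z hz
      obtain ⟨k, rfl⟩ := hmem.1 hz
      exact hmem.2 ⟨g⁻¹ * k, by rw [map_mul]; rfl⟩
    · rintro z hz
      obtain ⟨k, rfl⟩ := hmem.1 hz
      exact hmem.2 ⟨g * k, by rw [map_mul]; rfl⟩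
    · intro z _
      rw [map_inv]; exact (ρ g).apply_symm_apply z
    · intro z _
      rw [map_inv]; exact (ρ g).symm_apply_apply z
    · intro z _
      rw [← (ρ g).dist_eq (ρ g⁻¹ z) x, map_inv]
      congr 2
      exact ((ρ g).apply_symm_apply z).symm
  have : Nonempty X := ⟨p⟩
  obtain ⟨q, hq⟩ := exists_forall_le_of_midpoint hcont one_pos hle hmid
  refine ⟨q, fun g => ?_⟩
  exact eq_of_forall_le_of_midpoint (fun x => one_pos.trans_le (hle x)) hmid
    (fun x => (hinv g q).trans_le (hq x)) hq

/-! ### Busemann functions -/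

theorem Real.exp_le_two_mul_cosh (d : ℝ) : Real.exp d ≤ 2 * Real.cosh d := by
  rw [Real.cosh_eq]
  linarith [Real.exp_pos (-d)]

theorem Real.two_mul_cosh_le {d : ℝ} (hd : 0 ≤ d) : 2 * Real.cosh d ≤ Real.exp d + 1 := by
  rw [Real.cosh_eq]
  linarith [Real.exp_le_one_iff.2 (neg_nonpos.2 hd)]

theorem Real.cosh_le_exp {d : ℝ} (hd : 0 ≤ d) : Real.cosh d ≤ Real.exp d := by
  linarith [Real.two_mul_cosh_le hd, Real.one_le_exp hd]

namespace GeodesicRay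

variable {X : Type*} [MetricSpace X] (σ τ : GeodesicRay X)

/-- The Busemann function `x ↦ lim (dist x (σ t) - t)`, as `t → ∞`, of a geodesic ray `σ`. The
limit is taken of an antitone function bounded below, so that it is an infimum. -/
noncomputable def busemann (x : X) : ℝ := ⨅ t : ℝ≥0, (dist x (σ.1 t) - t)

theorem dist_apply (s t : ℝ≥0) : dist (σ.1 s) (σ.1 t) = |(s : ℝ) - t| := by
  rw [σ.2.dist_eq, NNReal.dist_eq]

theorem antitone_dist_sub (x : X) : Antitone fun t : ℝ≥0 => dist x (σ.1 t) - t := by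
  intro s t hst
  have h := dist_triangle x (σ.1 s) (σ.1 t)
  have hst' : (s : ℝ) ≤ t := hst
  rw [dist_apply, abs_sub_comm, abs_of_nonneg (by linarith)] at h
  change dist x (σ.1 t) - t ≤ dist x (σ.1 s) - s
  linarith

theorem bddBelow_dist_sub (x : X) : BddBelow (Set.range fun t : ℝ≥0 => dist x (σ.1 t) - t) := by
  refine ⟨-dist x (σ.1 0), ?_⟩
  rintro _ ⟨t, rfl⟩
  have h := dist_triangle_left (σ.1 0) (σ.1 t) x
  rw [dist_apply, abs_sub_comm, NNReal.coe_zero, sub_zero, NNReal.abs_eq] at h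
  change -dist x (σ.1 0) ≤ dist x (σ.1 t) - t
  linarith

theorem tendsto_busemann (x : X) :
    Filter.Tendsto (fun t : ℝ≥0 => dist x (σ.1 t) - t) Filter.atTop (nhds (σ.busemann x)) :=
  tendsto_atTop_ciInf (σ.antitone_dist_sub x) (σ.bddBelow_dist_sub x)

theorem busemann_le (x : X) (t : ℝ≥0) : σ.busemann x ≤ dist x (σ.1 t) - t :=
  ciInf_le (σ.bddBelow_dist_sub x) t

theorem tendsto_busemann_shift (x : X) (κ : ℝ≥0) :
    Filter.Tendsto (fun t : ℝ≥0 => dist x (σ.1 (t + κ)) - t) Filter.atTop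
      (nhds (σ.busemann x + κ)) := by
  have h := ((σ.tendsto_busemann x).comp
    (Filter.tendsto_atTop_mono (fun t => le_self_add (a := t) (b := κ))
      Filter.tendsto_id)).add_const (κ : ℝ)
  refine h.congr fun t => ?_
  simp only [Function.comp]
  rw [NNReal.coe_add]
  ring

theorem busemann_le_add (x y : X) : σ.busemann x ≤ σ.busemann y + dist x y := by
  refine le_of_tendsto_of_tendsto' (σ.tendsto_busemann x)
    ((σ.tendsto_busemann y).add_const (dist x y)) fun t => ?_
  linarith [dist_triangle x y (σ.1 t)]

theorem abs_busemann_sub_le (x y : X) : |σ.busemann x - σ.busemann y| ≤ dist x y := by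
  rw [abs_le]
  constructor
  · linarith [σ.busemann_le_add y x, dist_comm x y]
  · linarith [σ.busemann_le_add x y]

theorem continuous_busemann : Continuous σ.busemann :=
  (LipschitzWith.of_le_add σ.busemann_le_add).continuous

theorem busemann_map (φ : X ≃ᵢ X) (x : X) : (σ.map φ).busemann (φ x) = σ.busemann x := by
  refine iInf_congr fun t => ?_
  change dist (φ x) (φ (σ.1 t)) - t = _
  rw [φ.dist_eq]

theorem tendsto_exp_neg : Filter.Tendsto (fun t : ℝ≥0 => Real.exp (-t)) Filter.atTop (nhds 0) :=
  Real.tendsto_exp_neg_atTop_nhds_zero.comp (NNReal.tendsto_coe_atTop.2 Filter.tendsto_id)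

end GeodesicRay

namespace IsCATNegOne

open GeodesicRay

variable {X : Type*} [MetricSpace X]

/-- The functions `exp ∘ busemann` inherit the midpoint inequality of `cosh ∘ dist`. The midpoint
does not depend on the ray. -/
theorem exists_midpoint_busemann (hX : IsCATNegOne X) (x y : X) :
    ∃ m, ∀ σ : GeodesicRay X, Real.exp (σ.busemann m) * Real.cosh (dist x y / 2) ≤
      (Real.exp (σ.busemann x) + Real.exp (σ.busemann y)) / 2 := by
  obtain ⟨m, hm⟩ := hX.exists_midpoint x y
  refine ⟨m, fun σ => ?_⟩
  have hlim : ∀ z, Filter.Tendsto (fun t : ℝ≥0 => Real.exp (dist z (σ.1 t) - t)) Filter.atTop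
      (nhds (Real.exp (σ.busemann z))) := fun z =>
    (Real.continuous_exp.tendsto _).comp (σ.tendsto_busemann z)
  have hrhs := (((hlim x).add (hlim y)).div_const 2).add tendsto_exp_neg
  rw [add_zero] at hrhs
  refine le_of_tendsto_of_tendsto' ((hlim m).mul_const _) hrhs fun t => ?_
  have h := hm (σ.1 t)
  rw [dist_comm _ m, dist_comm (σ.1 t) x, dist_comm (σ.1 t) y] at h
  have h₁ := mul_le_mul_of_nonneg_right (Real.exp_le_two_mul_cosh (dist m (σ.1 t)))
    (Real.cosh_pos (dist x y / 2)).le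
  have h₂ := Real.two_mul_cosh_le (dist_nonneg (x := x) (y := σ.1 t))
  have h₃ := Real.two_mul_cosh_le (dist_nonneg (x := y) (y := σ.1 t))
  simp only [sub_eq_add_neg, Real.exp_add]
  have h₄ := Real.exp_pos (-(t : ℝ))
  have h₅ : Real.exp (dist m (σ.1 t)) * Real.cosh (dist x y / 2) ≤
      (Real.exp (dist x (σ.1 t)) + Real.exp (dist y (σ.1 t))) / 2 + 1 := by linarith
  nlinarith

/-- The quadrilateral inequality for `x`, `y` and two far points on `σ` and `τ` becomes a
cross-ratio inequality in the limit, as the distance of the far points does not count. -/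
theorem busemann_add_busemann_le (hX : IsCATNegOne X) {σ τ : GeodesicRay X}
    (h : σ.Asymptotic τ) (x y : X) :
    σ.busemann x + τ.busemann y ≤ σ.busemann y + τ.busemann x := by
  obtain ⟨K, hK⟩ := h
  -- the far points are `σ (t + κ₁)` and `τ (t + κ₂)`; the shifts make the limits of two opposite
  -- sides equal
  obtain ⟨κ₁, κ₂, hκ⟩ : ∃ κ₁ κ₂ : ℝ≥0, σ.busemann y + κ₁ = τ.busemann x + κ₂ := by
    rcases le_total (σ.busemann y) (τ.busemann x) with h | h
    · exact ⟨(τ.busemann x - σ.busemann y).toNNReal, 0, by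
        rw [Real.coe_toNNReal _ (sub_nonneg.2 h), NNReal.coe_zero]; ring⟩
    · exact ⟨0, (σ.busemann y - τ.busemann x).toNNReal, by
        rw [Real.coe_toNNReal _ (sub_nonneg.2 h), NNReal.coe_zero]; ring⟩
  set C := Real.cosh (dist x y) + Real.cosh (κ₁ + K + κ₂) + 1 with hC
  have hexp : ∀ {f : ℝ≥0 → ℝ} {b : ℝ}, Filter.Tendsto f Filter.atTop (nhds b) →
      Filter.Tendsto (fun t => Real.exp (f t)) Filter.atTop (nhds (Real.exp b)) := fun hf =>
    (Real.continuous_exp.tendsto _).comp hf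
  have hlhs := hexp (((σ.tendsto_busemann_shift x κ₁).add
    (τ.tendsto_busemann_shift y κ₂)).div_const 2)
  have hrhs := (((hexp (σ.tendsto_busemann_shift y κ₁)).add
    (hexp (τ.tendsto_busemann_shift x κ₂))).div_const 2).add (tendsto_exp_neg.const_mul C)
  rw [mul_zero, add_zero, hκ, add_self_div_two] at hrhs
  have hle := le_of_tendsto_of_tendsto' hlhs hrhs fun t => by
    have hq := hX.cosh_mul_cosh_le x y (σ.1 (t + κ₁)) (τ.1 (t + κ₂))
    have h₁ := Real.exp_le_two_mul_cosh (dist x (σ.1 (t + κ₁)) / 2)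
    have h₂ := Real.exp_le_two_mul_cosh (dist y (τ.1 (t + κ₂)) / 2)
    have h₃ := Real.two_mul_cosh_le (dist_nonneg (x := y) (y := σ.1 (t + κ₁)))
    have h₄ := Real.two_mul_cosh_le (dist_nonneg (x := x) (y := τ.1 (t + κ₂)))
    have h₅ : Real.cosh (dist (σ.1 (t + κ₁)) (τ.1 (t + κ₂))) ≤ Real.cosh (κ₁ + K + κ₂) := by
      have h₆ := dist_triangle4 (σ.1 (t + κ₁)) (σ.1 t) (τ.1 t) (τ.1 (t + κ₂))
      rw [dist_apply, dist_apply, NNReal.coe_add, NNReal.coe_add, add_sub_cancel_left,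
        sub_add_cancel_left, abs_neg, NNReal.abs_eq, NNReal.abs_eq] at h₆
      refine Real.cosh_le_cosh.2 ?_
      rw [abs_of_nonneg dist_nonneg]
      exact le_trans (by linarith [hK t]) (le_abs_self _)
    rw [dist_comm (τ.1 _) x] at hq
    have h₇ : Real.exp ((dist x (σ.1 (t + κ₁)) + dist y (τ.1 (t + κ₂))) / 2) ≤
        (Real.exp (dist y (σ.1 (t + κ₁))) + Real.exp (dist x (τ.1 (t + κ₂)))) / 2 + C := by
      rw [add_div, Real.exp_add]
      have h₈ := mul_le_mul h₁ h₂ (Real.exp_pos _).le (by positivity)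
      linarith
    have h₉ : (dist x (σ.1 (t + κ₁)) - t + (dist y (τ.1 (t + κ₂)) - t)) / 2 =
        (dist x (σ.1 (t + κ₁)) + dist y (τ.1 (t + κ₂))) / 2 + -t := by ring
    rw [h₉, sub_eq_add_neg, sub_eq_add_neg, Real.exp_add, Real.exp_add, Real.exp_add]
    have := Real.exp_pos (-(t : ℝ))
    nlinarith
  have := Real.exp_le_exp.1 hle
  linarith

/-- The Busemann functions of asymptotic rays differ by a constant. -/
theorem exists_busemann_eq_add (hX : IsCATNegOne X) {σ τ : GeodesicRay X}
    (h : σ.Asymptotic τ) : ∃ c, ∀ x, τ.busemann x = σ.busemann x + c := by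
  refine ⟨τ.busemann (σ.1 0) - σ.busemann (σ.1 0), fun x => ?_⟩
  have h₁ := hX.busemann_add_busemann_le h x (σ.1 0)
  have h₂ := hX.busemann_add_busemann_le h (σ.1 0) x
  linarith

/-- From every point one can go towards the end of `σ`, up to an arbitrarily small error. -/
theorem exists_dist_le_busemann_le (hX : IsCATNegOne X) (σ : GeodesicRay X) (x : X) {s δ : ℝ}
    (hs : 0 ≤ s) (hδ : 0 < δ) : ∃ y, dist x y ≤ s ∧ σ.busemann y ≤ σ.busemann x - s + δ := by
  have hd : ∀ᶠ t : ℝ≥0 in Filter.atTop, dist x (σ.1 t) - t < σ.busemann x + δ :=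
    (σ.tendsto_busemann x).eventually_lt_const (by linarith)
  obtain ⟨t, ht, hst⟩ := (hd.and
    (Filter.eventually_ge_atTop (Real.toNNReal (s - σ.busemann x)))).exists
  have hst' : s ≤ dist x (σ.1 t) := by
    have h₁ := σ.busemann_le x t
    have h₂ := Real.toNNReal_le_iff_le_coe.1 hst
    linarith
  obtain ⟨α, h₀, h₁, hα⟩ := hX.exists_geodesic x (σ.1 t)
  refine ⟨α s, ?_, ?_⟩
  · have := hα 0 ⟨le_rfl, dist_nonneg⟩ s ⟨hs, hst'⟩
    rw [h₀, zero_sub, abs_neg, abs_of_nonneg hs] at this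
    exact this.le
  · have := hα s ⟨hs, hst'⟩ _ ⟨dist_nonneg, le_rfl⟩
    rw [h₁, abs_sub_comm, abs_of_nonneg (by linarith)] at this
    linarith [σ.busemann_le (α s) t]

theorem cosh_dist_ray_mul_sinh_le (hX : IsCATNegOne X) (σ : GeodesicRay X) (r : X) {s n : ℝ≥0}
    (hsn : s ≤ n) :
    Real.cosh (dist r (σ.1 s)) * Real.sinh n ≤
      Real.cosh (dist r (σ.1 0)) * Real.sinh (n - s) +
        Real.cosh (dist r (σ.1 n)) * Real.sinh s := by
  have hn : dist (σ.1 0) (σ.1 n) = n := by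
    rw [dist_apply, NNReal.coe_zero, zero_sub, abs_neg, NNReal.abs_eq]
  have hseg : IsGeodesicSegment (fun u : ℝ => σ.1 u.toNNReal) (σ.1 0) (σ.1 n) := by
    refine ⟨by simp, by simp [hn], fun u hu v hv => ?_⟩
    simp only
    rw [dist_apply, Real.coe_toNNReal _ hu.1, Real.coe_toNNReal _ hv.1]
  have := hX.cosh_dist_mul_sinh_le r hseg (s := s) ⟨s.2, by rw [hn]; exact hsn⟩
  simpa only [hn, Real.toNNReal_coe] using this

/-- If `σ.busemann + τ.busemann` takes values below `-M`, then far points `σ n`, `τ n` have distance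
less than `2 * n - M`; by convexity, this bounds `dist (σ s) (τ s)` for `s ≤ M / 2`. -/
theorem cosh_dist_le_of_busemann_add_lt (hX : IsCATNegOne X) {σ τ : GeodesicRay X} {x : X}
    {s : ℝ≥0} (hx : σ.busemann x + τ.busemann x < -(2 * s)) :
    Real.cosh (dist (σ.1 s) (τ.1 s)) ≤ 5 * Real.exp (dist (σ.1 0) (τ.1 0)) + 16 := by
  have hd : ∀ᶠ n : ℝ≥0 in Filter.atTop,
      (dist x (σ.1 n) - n) + (dist x (τ.1 n) - n) < -(2 * s) :=
    ((σ.tendsto_busemann x).add (τ.tendsto_busemann x)).eventually_lt_const hx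
  obtain ⟨n, hn, hn₁, hsn⟩ := (hd.and ((Filter.eventually_ge_atTop 1).and
    (Filter.eventually_ge_atTop s))).exists
  set D := dist (σ.1 0) (τ.1 0) with hD
  have hn₁' : (1 : ℝ) ≤ n := hn₁
  have hsn' : (s : ℝ) ≤ n := hsn
  have hs₀ : (0 : ℝ) ≤ s := s.2
  have hexp₁ : Real.exp n * Real.exp (-n) = 1 := by rw [← Real.exp_add]; simp
  have hexp₂ : 2 ≤ Real.exp n := by linarith [Real.add_one_le_exp (n : ℝ)]
  have hsinh : Real.exp n ≤ 4 * Real.sinh n := by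
    rw [Real.sinh_eq]
    nlinarith [Real.exp_pos (-(n : ℝ))]
  have hsinh_pos : 0 < Real.sinh n := by linarith
  have hsinh_sub : Real.sinh (n - s) ≤ Real.exp (-s) * Real.sinh n := by
    rw [Real.sinh_sub, ← Real.cosh_sub_sinh (s : ℝ)]
    nlinarith [Real.sinh_nonneg_iff.2 hs₀, Real.sinh_lt_cosh (n : ℝ)]
  have hsinh_s : Real.sinh s ≤ Real.exp s := by
    rw [← Real.cosh_add_sinh]
    linarith [Real.cosh_pos (s : ℝ)]
  have hsinh_s' : 0 ≤ Real.sinh s := Real.sinh_nonneg_iff.2 hs₀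
  have hsinh_sub' : 0 ≤ Real.sinh (n - s) := Real.sinh_nonneg_iff.2 (by linarith)
  have hcosh : ∀ {y z : X} {e : ℝ}, dist y z ≤ e → Real.cosh (dist y z) ≤ Real.exp e := fun h =>
    (Real.cosh_le_exp dist_nonneg).trans (Real.exp_le_exp.2 h)
  have hs0 : dist (σ.1 s) (σ.1 0) = s := by simp [dist_apply]
  have hn0 : dist (τ.1 0) (τ.1 n) = n := by simp [dist_apply]
  have h₁ : Real.cosh (dist (σ.1 s) (τ.1 0)) ≤ Real.exp (s + D) :=
    hcosh (by linarith [dist_triangle (σ.1 s) (σ.1 0) (τ.1 0)])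
  have h₂ : Real.cosh (dist (τ.1 n) (σ.1 0)) ≤ Real.exp (n + D) :=
    hcosh (by
      rw [dist_comm]
      linarith [dist_triangle (σ.1 0) (τ.1 0) (τ.1 n)])
  have h₃ : Real.cosh (dist (τ.1 n) (σ.1 n)) ≤ Real.exp (2 * n - 2 * s) :=
    hcosh (by linarith [dist_triangle_left (τ.1 n) (σ.1 n) x])
  have h₄ := hX.cosh_dist_ray_mul_sinh_le σ (τ.1 n) hsn
  have h₅ := hX.cosh_dist_ray_mul_sinh_le τ (σ.1 s) hsn
  rw [dist_comm (σ.1 s) (τ.1 n)] at h₅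
  have h₆ : Real.cosh (dist (τ.1 n) (σ.1 s)) ≤
      Real.exp (n + D) * Real.exp (-s) + 4 * Real.exp (n - s) := by
    refine le_of_mul_le_mul_right ?_ hsinh_pos
    calc _ ≤ Real.exp (n + D) * (Real.exp (-s) * Real.sinh n) +
            Real.exp (2 * n - 2 * s) * Real.exp s := by
          refine h₄.trans (add_le_add ?_ ?_) <;> gcongr
      _ = Real.exp (n + D) * Real.exp (-s) * Real.sinh n + Real.exp (n - s) * Real.exp n := by
          rw [← Real.exp_add (2 * (n : ℝ) - _), ← Real.exp_add (n - s : ℝ), mul_assoc]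
          ring_nf
      _ ≤ Real.exp (n + D) * Real.exp (-s) * Real.sinh n +
            Real.exp (n - s) * (4 * Real.sinh n) := by gcongr
      _ = _ := by ring
  refine le_of_mul_le_mul_right ?_ hsinh_pos
  calc _ ≤ Real.exp (s + D) * (Real.exp (-s) * Real.sinh n) +
          (Real.exp (n + D) * Real.exp (-s) + 4 * Real.exp (n - s)) * Real.exp s := by
        refine h₅.trans (add_le_add ?_ ?_) <;> gcongr
    _ = Real.exp D * Real.sinh n + (Real.exp D + 4) * Real.exp n := by
        simp only [sub_eq_add_neg, Real.exp_add]
        have : Real.exp (s : ℝ) * Real.exp (-s) = 1 := by rw [← Real.exp_add]; simp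
        linear_combination (Real.exp D * Real.sinh n + Real.exp n * Real.exp D +
          4 * Real.exp n) * this
    _ ≤ Real.exp D * Real.sinh n + (Real.exp D + 4) * (4 * Real.sinh n) := by gcongr
    _ = _ := by ring

theorem bddBelow_busemann_add (hX : IsCATNegOne X) {σ τ : GeodesicRay X}
    (h : ¬ σ.Asymptotic τ) :
    BddBelow (Set.range fun x => σ.busemann x + τ.busemann x) := by
  by_contra hb
  refine h ⟨2 * (5 * Real.exp (dist (σ.1 0) (τ.1 0)) + 16), fun s => ?_⟩
  obtain ⟨_, ⟨x, rfl⟩, hx⟩ := not_bddBelow_iff.1 hb (-(2 * s))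
  have h₁ := hX.cosh_dist_le_of_busemann_add_lt hx
  have h₂ := Real.add_one_le_exp (dist (σ.1 s) (τ.1 s))
  have h₃ := Real.exp_le_two_mul_cosh (dist (σ.1 s) (τ.1 s))
  linarith

end IsCATNegOne

/-! ### The geodesic joining two boundary points -/

theorem Real.two_mul_exp_half_add_le (a b : ℝ) :
    2 * Real.exp ((a + b) / 2) ≤ Real.exp a + Real.exp b := by
  have ha : Real.exp a = Real.exp (a / 2) ^ 2 := by rw [← Real.exp_nat_mul]; push_cast; ring_nf
  have hb : Real.exp b = Real.exp (b / 2) ^ 2 := by rw [← Real.exp_nat_mul]; push_cast; ring_nf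
  rw [add_div, Real.exp_add, ha, hb]
  nlinarith [sq_nonneg (Real.exp (a / 2) - Real.exp (b / 2))]

theorem Real.eq_and_eq_of_exp_add_exp_le {a b c : ℝ} (h : 2 * c ≤ a + b)
    (hle : Real.exp a + Real.exp b ≤ 2 * Real.exp c) : a = c ∧ b = c := by
  have ha : Real.exp a = Real.exp (a / 2) ^ 2 := by rw [← Real.exp_nat_mul]; push_cast; ring_nf
  have hb : Real.exp b = Real.exp (b / 2) ^ 2 := by rw [← Real.exp_nat_mul]; push_cast; ring_nf
  have hc : Real.exp c ≤ Real.exp (a / 2) * Real.exp (b / 2) := by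
    rw [← Real.exp_add]
    exact Real.exp_le_exp.2 (by linarith)
  have h₀ : (Real.exp (a / 2) - Real.exp (b / 2)) ^ 2 ≤ 0 := by nlinarith
  have h₁ : Real.exp (a / 2) - Real.exp (b / 2) = 0 := by
    exact pow_eq_zero_iff two_ne_zero |>.1 (le_antisymm h₀ (sq_nonneg _))
  have h₂ : a = b := by linarith [Real.exp_injective (sub_eq_zero.1 h₁)]
  subst h₂
  have h₃ : a ≤ c := Real.exp_le_exp.1 (by linarith)
  constructor <;> linarith

namespace IsCATNegOne

open GeodesicRay

variable {X : Type*} [MetricSpace X]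

/-- For each `u`, the function `exp (u + σ.busemann ·) + exp (-u + τ.busemann ·)` satisfies the
midpoint inequality. Its minimizer will be the point with parameter `u` of the geodesic joining the
ends of `τ` and `σ`. -/
theorem exists_midpoint_exp_add_exp (hX : IsCATNegOne X) (σ τ : GeodesicRay X) (u : ℝ) (x y : X) :
    ∃ m, (Real.exp (u + σ.busemann m) + Real.exp (-u + τ.busemann m)) *
        Real.cosh (dist x y / 2) ≤
      ((Real.exp (u + σ.busemann x) + Real.exp (-u + τ.busemann x)) +
        (Real.exp (u + σ.busemann y) + Real.exp (-u + τ.busemann y))) / 2 := by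
  obtain ⟨m, hm⟩ := hX.exists_midpoint_busemann x y
  refine ⟨m, ?_⟩
  simp only [Real.exp_add]
  have h₁ := mul_le_mul_of_nonneg_left (hm σ) (Real.exp_pos u).le
  have h₂ := mul_le_mul_of_nonneg_left (hm τ) (Real.exp_pos (-u)).le
  linarith

theorem two_mul_exp_le {σ τ : GeodesicRay X} {μ : ℝ}
    (hμ : ∀ x, μ ≤ σ.busemann x + τ.busemann x) (u : ℝ) (x : X) :
    2 * Real.exp (μ / 2) ≤ Real.exp (u + σ.busemann x) + Real.exp (-u + τ.busemann x) := by
  refine le_trans ?_ (Real.two_mul_exp_half_add_le _ _)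
  have := Real.exp_le_exp.2 (show μ / 2 ≤ (u + σ.busemann x + (-u + τ.busemann x)) / 2 by
    linarith [hμ x])
  linarith

/-- The points where `σ.busemann + τ.busemann` is minimal are at the distance prescribed by the
values of `σ.busemann`. -/
theorem dist_eq_of_busemann (hX : IsCATNegOne X) {σ τ : GeodesicRay X} {μ : ℝ}
    (hμ : ∀ x, μ ≤ σ.busemann x + τ.busemann x) {x y : X} {u v : ℝ}
    (hx₁ : σ.busemann x = μ / 2 - u) (hx₂ : τ.busemann x = μ / 2 + u)
    (hy₁ : σ.busemann y = μ / 2 - v) (hy₂ : τ.busemann y = μ / 2 + v) : dist x y = |u - v| := by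
  apply le_antisymm
  · obtain ⟨m, hm⟩ := hX.exists_midpoint_exp_add_exp σ τ ((u + v) / 2) x y
    have h₁ := two_mul_exp_le hμ ((u + v) / 2) m
    have e₁ : (u + v) / 2 + (μ / 2 - u) = μ / 2 + -((u - v) / 2) := by ring
    have e₂ : -((u + v) / 2) + (μ / 2 + u) = μ / 2 + (u - v) / 2 := by ring
    have e₃ : (u + v) / 2 + (μ / 2 - v) = μ / 2 + (u - v) / 2 := by ring
    have e₄ : -((u + v) / 2) + (μ / 2 + v) = μ / 2 + -((u - v) / 2) := by ring
    rw [hx₁, hx₂, hy₁, hy₂, e₁, e₂, e₃, e₄, Real.exp_add (μ / 2), Real.exp_add (μ / 2)] at hm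
    have h₂ : Real.cosh (dist x y / 2) ≤ Real.cosh ((u - v) / 2) := by
      have h₃ := mul_le_mul_of_nonneg_right h₁ (Real.cosh_pos (dist x y / 2)).le
      refine le_of_mul_le_mul_left ?_ (show 0 < 2 * Real.exp (μ / 2) by positivity)
      rw [Real.cosh_eq ((u - v) / 2)]
      linarith
    have h₄ := Real.cosh_le_cosh.1 h₂
    rw [abs_of_nonneg (by positivity), abs_div, abs_two] at h₄
    linarith
  · have := σ.abs_busemann_sub_le x y
    rwa [hx₁, hy₁, sub_sub_sub_cancel_left, abs_sub_comm] at this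

/-- Moving a point towards the end of `σ` or `τ` hardly increases `σ.busemann + τ.busemann` and
balances the two exponentials. -/
theorem exists_exp_add_exp_le (hX : IsCATNegOne X) (σ τ : GeodesicRay X) (u : ℝ) (x : X) {δ : ℝ}
    (hδ : 0 < δ) :
    ∃ y, Real.exp (u + σ.busemann y) + Real.exp (-u + τ.busemann y) ≤
      2 * Real.exp ((σ.busemann x + τ.busemann x) / 2 + δ) := by
  rcases le_total 0 ((2 * u + σ.busemann x - τ.busemann x) / 2) with h | h
  · obtain ⟨y, hxy, hy⟩ := hX.exists_dist_le_busemann_le σ x h hδ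
    have h₁ := τ.busemann_le_add y x
    rw [dist_comm] at h₁
    have h₂ := Real.exp_le_exp.2 (show u + σ.busemann y ≤
      (σ.busemann x + τ.busemann x) / 2 + δ by linarith)
    have h₃ := Real.exp_le_exp.2 (show -u + τ.busemann y ≤
      (σ.busemann x + τ.busemann x) / 2 + δ by linarith)
    exact ⟨y, by linarith⟩
  · obtain ⟨y, hxy, hy⟩ := hX.exists_dist_le_busemann_le τ x (neg_nonneg.2 h) hδ
    have h₁ := σ.busemann_le_add y x
    rw [dist_comm] at h₁
    have h₂ := Real.exp_le_exp.2 (show u + σ.busemann y ≤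
      (σ.busemann x + τ.busemann x) / 2 + δ by linarith)
    have h₃ := Real.exp_le_exp.2 (show -u + τ.busemann y ≤
      (σ.busemann x + τ.busemann x) / 2 + δ by linarith)
    exact ⟨y, by linarith⟩

variable [CompleteSpace X]

theorem exists_busemann_eq (hX : IsCATNegOne X) {σ τ : GeodesicRay X} {μ : ℝ}
    (hμ : IsGLB (Set.range fun x => σ.busemann x + τ.busemann x) μ) (u : ℝ) :
    ∃ x, σ.busemann x = μ / 2 - u ∧ τ.busemann x = μ / 2 + u := by
  have hle : ∀ x, μ ≤ σ.busemann x + τ.busemann x := fun x => hμ.1 ⟨x, rfl⟩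
  have : Nonempty X := ⟨σ.1 0⟩
  have hcont : Continuous fun x =>
      Real.exp (u + σ.busemann x) + Real.exp (-u + τ.busemann x) := by
    have h₁ := σ.continuous_busemann
    have h₂ := τ.continuous_busemann
    fun_prop
  obtain ⟨p, hp⟩ := exists_forall_le_of_midpoint hcont
    (show 0 < 2 * Real.exp (μ / 2) by positivity) (two_mul_exp_le hle u)
    (hX.exists_midpoint_exp_add_exp σ τ u)
  have hp' : ∀ δ : ℝ, 0 < δ →
      Real.exp (u + σ.busemann p) + Real.exp (-u + τ.busemann p) ≤ 2 * Real.exp (μ / 2 + δ) := by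
    intro δ hδ
    obtain ⟨_, ⟨x, rfl⟩, -, hx⟩ := hμ.exists_between (lt_add_of_pos_right μ hδ)
    obtain ⟨y, hy⟩ := hX.exists_exp_add_exp_le σ τ u x (half_pos hδ)
    refine (hp y).trans (hy.trans ?_)
    have := Real.exp_le_exp.2
      (show (σ.busemann x + τ.busemann x) / 2 + δ / 2 ≤ μ / 2 + δ by
        simp only at hx
        linarith)
    linarith
  have hlim : Filter.Tendsto (fun δ : ℝ => 2 * Real.exp (μ / 2 + δ)) (nhdsWithin 0 (Set.Ioi 0))
      (nhds (2 * Real.exp (μ / 2 + 0))) := by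
    have : Continuous fun δ : ℝ => 2 * Real.exp (μ / 2 + δ) := by fun_prop
    exact (this.tendsto 0).mono_left nhdsWithin_le_nhds
  rw [add_zero] at hlim
  have hle' := ge_of_tendsto hlim (eventually_nhdsWithin_of_forall fun δ hδ => hp' δ hδ)
  obtain ⟨h₁, h₂⟩ := Real.eq_and_eq_of_exp_add_exp_le (by linarith [hle p]) hle'
  exact ⟨p, by linarith, by linarith⟩

/-- Two distinct boundary points are joined by a geodesic, which is the set of minimizers of the sum
of two Busemann functions. -/
theorem exists_geodesic_line (hX : IsCATNegOne X) {σ τ : GeodesicRay X}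
    (h : ¬ σ.Asymptotic τ) :
    ∃ (μ : ℝ) (γ : ℝ → X), Isometry γ ∧ (∀ x, μ ≤ σ.busemann x + τ.busemann x) ∧
      (∀ u, σ.busemann (γ u) = μ / 2 - u ∧ τ.busemann (γ u) = μ / 2 + u) ∧
      ∀ x u, σ.busemann x = μ / 2 - u → τ.busemann x = μ / 2 + u → x = γ u := by
  have : Nonempty X := ⟨σ.1 0⟩
  have hglb := isGLB_ciInf (hX.bddBelow_busemann_add h)
  set μ := ⨅ x, σ.busemann x + τ.busemann x
  have hle : ∀ x, μ ≤ σ.busemann x + τ.busemann x := fun x => hglb.1 ⟨x, rfl⟩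
  choose γ hγ using hX.exists_busemann_eq hglb
  refine ⟨μ, γ, Isometry.of_dist_eq fun u v => ?_, hle, hγ, fun x u hx₁ hx₂ => ?_⟩
  · exact hX.dist_eq_of_busemann hle (hγ u).1 (hγ u).2 (hγ v).1 (hγ v).2
  · rw [← dist_eq_zero, hX.dist_eq_of_busemann hle hx₁ hx₂ (hγ u).1 (hγ u).2, sub_self, abs_zero]

end IsCATNegOne

/-! ### Isometries acting on the boundary -/

namespace BoundaryAtInfinity

variable {X : Type*} [MetricSpace X]

theorem mk_eq_mk {σ τ : GeodesicRay X} :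
    (Quotient.mk (GeodesicRay.setoid X) σ : BoundaryAtInfinity X) =
      Quotient.mk (GeodesicRay.setoid X) τ ↔ σ.Asymptotic τ :=
  Quotient.eq (r := GeodesicRay.setoid X)

theorem map_mul (φ ψ : X ≃ᵢ X) (ξ : BoundaryAtInfinity X) :
    map (φ * ψ) ξ = map φ (map ψ ξ) := by
  induction ξ using Quotient.inductionOn
  rfl

theorem map_one (ξ : BoundaryAtInfinity X) : map (1 : X ≃ᵢ X) ξ = ξ := by
  induction ξ using Quotient.inductionOn
  rfl

theorem map_inv_map (φ : X ≃ᵢ X) (ξ : BoundaryAtInfinity X) : map φ⁻¹ (map φ ξ) = ξ := by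
  rw [← map_mul, inv_mul_cancel, map_one]

theorem map_injective (φ : X ≃ᵢ X) : Function.Injective (map φ) :=
  Function.LeftInverse.injective (map_inv_map φ)

theorem exists_busemann_eq_of_map_eq (hX : IsCATNegOne X) {φ : X ≃ᵢ X} {σ τ : GeodesicRay X}
    (h : map φ (Quotient.mk (GeodesicRay.setoid X) σ) = Quotient.mk (GeodesicRay.setoid X) τ) :
    ∃ c, ∀ x, τ.busemann (φ x) = σ.busemann x + c := by
  obtain ⟨c, hc⟩ := hX.exists_busemann_eq_add (mk_eq_mk.1 h)
  exact ⟨c, fun x => by rw [hc, GeodesicRay.busemann_map]⟩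

end BoundaryAtInfinity

/-- If a function that has a minimum changes by a constant under a permutation, then the constant
is zero. -/
theorem eq_zero_of_forall_apply_eq_add {X : Type*} {f : X → ℝ} {p : X} (hp : ∀ x, f p ≤ f x)
    (e : X ≃ X) {k : ℝ} (h : ∀ x, f (e x) = f x + k) : k = 0 := by
  apply le_antisymm
  · have := h (e.symm p)
    rw [e.apply_symm_apply] at this
    linarith [hp (e.symm p)]
  · linarith [hp (e p), h p]

namespace IsCATNegOne

open BoundaryAtInfinity

variable {X : Type*} [MetricSpace X] [CompleteSpace X] {G : Type*} [Group G]

/-- An isometry that fixes two distinct boundary points changes their Busemann functions by opposite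
constants. -/
theorem add_eq_zero_of_busemann_eq (hX : IsCATNegOne X) {σ τ : GeodesicRay X}
    (h : ¬ σ.Asymptotic τ) (φ : X ≃ᵢ X) {c d : ℝ}
    (hc : ∀ x, σ.busemann (φ x) = σ.busemann x + c)
    (hd : ∀ x, τ.busemann (φ x) = τ.busemann x + d) : c + d = 0 := by
  obtain ⟨μ, γ, -, hμ, hγ, -⟩ := hX.exists_geodesic_line h
  refine eq_zero_of_forall_apply_eq_add (f := fun x => σ.busemann x + τ.busemann x) (p := γ 0)
    (fun x => ?_) φ.toEquiv (fun x => ?_)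
  · simp only [hγ]
    linarith [hμ x]
  · change σ.busemann (φ x) + τ.busemann (φ x) = _
    rw [hc, hd]
    ring

theorem preservesGeodesic_of_pair (hX : IsCATNegOne X) (ρ : G →* (X ≃ᵢ X))
    {ξ η : BoundaryAtInfinity X} (hne : ξ ≠ η)
    (h : ∀ g, map (ρ g) ξ = ξ ∧ map (ρ g) η = η ∨ map (ρ g) ξ = η ∧ map (ρ g) η = ξ) :
    PreservesGeodesic ρ := by
  induction ξ using Quotient.inductionOn with | _ σ
  induction η using Quotient.inductionOn with | _ τ
  obtain ⟨μ, γ, hγiso, hμ, hγ, huniq⟩ :=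
    hX.exists_geodesic_line (fun h => hne (mk_eq_mk.2 h))
  have hinv : ∀ g x, σ.busemann (ρ g x) + τ.busemann (ρ g x) = σ.busemann x + τ.busemann x := by
    intro g
    obtain ⟨k, hk⟩ : ∃ k, ∀ x, σ.busemann (ρ g x) + τ.busemann (ρ g x) =
        σ.busemann x + τ.busemann x + k := by
      rcases h g with ⟨h₁, h₂⟩ | ⟨h₁, h₂⟩
      all_goals
        obtain ⟨c, hc⟩ := exists_busemann_eq_of_map_eq hX h₁
        obtain ⟨d, hd⟩ := exists_busemann_eq_of_map_eq hX h₂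
        exact ⟨c + d, fun x => by rw [hc, hd]; ring⟩
    have hk₀ : k = 0 := by
      refine eq_zero_of_forall_apply_eq_add (f := fun x => σ.busemann x + τ.busemann x)
        (p := γ 0) (fun x => ?_) (ρ g).toEquiv hk
      simp only [hγ]
      linarith [hμ x]
    simpa [hk₀] using hk
  have hsub : ∀ g u, ∃ v, γ v = ρ g (γ u) := by
    intro g u
    have h₁ := hinv g (γ u)
    rw [(hγ u).1, (hγ u).2] at h₁
    exact ⟨μ / 2 - σ.busemann (ρ g (γ u)), (huniq _ _ (by ring) (by linarith)).symm⟩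
  refine ⟨γ, hγiso, fun g => Set.Subset.antisymm ?_ ?_⟩
  · rintro _ ⟨_, ⟨u, rfl⟩, rfl⟩
    exact hsub g u
  · rintro _ ⟨u, rfl⟩
    obtain ⟨v, hv⟩ := hsub g⁻¹ u
    refine ⟨γ v, ⟨v, rfl⟩, ?_⟩
    rw [hv, map_inv]
    exact (ρ g).apply_symm_apply (γ u)

/-- The isometries that fix three distinct boundary points have a common fixed point in `X`. -/
theorem exists_forall_fixed_of_triple (hX : IsCATNegOne X) {ξ η ζ : BoundaryAtInfinity X}
    (h₁₂ : ξ ≠ η) (h₁₃ : ξ ≠ ζ) (h₂₃ : η ≠ ζ) :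
    ∃ p : X, ∀ φ : X ≃ᵢ X, map φ ξ = ξ → map φ η = η → map φ ζ = ζ → φ p = p := by
  induction ξ using Quotient.inductionOn with | _ σ
  induction η using Quotient.inductionOn with | _ τ
  induction ζ using Quotient.inductionOn with | _ υ
  have h₁₂' := fun h => h₁₂ (mk_eq_mk.2 h)
  obtain ⟨μ, γ, -, -, hγ, huniq⟩ := hX.exists_geodesic_line h₁₂'
  refine ⟨γ 0, fun φ h₁ h₂ h₃ => ?_⟩
  obtain ⟨a, ha⟩ := exists_busemann_eq_of_map_eq hX h₁
  obtain ⟨b, hb⟩ := exists_busemann_eq_of_map_eq hX h₂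
  obtain ⟨c, hc⟩ := exists_busemann_eq_of_map_eq hX h₃
  have hab := hX.add_eq_zero_of_busemann_eq h₁₂' φ ha hb
  have hac := hX.add_eq_zero_of_busemann_eq (fun h => h₁₃ (mk_eq_mk.2 h)) φ ha hc
  have hbc := hX.add_eq_zero_of_busemann_eq (fun h => h₂₃ (mk_eq_mk.2 h)) φ hb hc
  have ha₀ : a = 0 := by linarith
  have hb₀ : b = 0 := by linarith
  exact huniq _ 0 (by rw [ha, (hγ 0).1, ha₀, add_zero]) (by rw [hb, (hγ 0).2, hb₀, add_zero])

/-- A finite orbit with at least three points in the boundary yields a finite orbit in `X`, because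
the elements of `G` that fix the points of a triple fix a point of `X`. -/
theorem exists_fixed_of_finite_boundary_orbit (hX : IsCATNegOne X) (ρ : G →* (X ≃ᵢ X))
    {ξ : BoundaryAtInfinity X} (hfin : (Set.range fun g => map (ρ g) ξ).Finite) {g₁ g₂ : G}
    (h₁ : ξ ≠ map (ρ g₁) ξ) (h₂ : ξ ≠ map (ρ g₂) ξ) (h₁₂ : map (ρ g₁) ξ ≠ map (ρ g₂) ξ) :
    ∃ q : X, ∀ g, ρ g q = q := by
  obtain ⟨p, hp⟩ := hX.exists_forall_fixed_of_triple h₁ h₂ h₁₂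
  refine hX.exists_fixed_of_finite_orbit ρ (p := p) ?_
  -- the orbit map of `p` factors through the map of `G` to the triples of orbit points
  set F : G → BoundaryAtInfinity X × BoundaryAtInfinity X × BoundaryAtInfinity X :=
    fun g => (map (ρ g) ξ, map (ρ (g * g₁)) ξ, map (ρ (g * g₂)) ξ) with hF
  have hFfin : (Set.range F).Finite := by
    refine (hfin.prod (hfin.prod hfin)).subset ?_
    rintro _ ⟨g, rfl⟩
    exact ⟨⟨g, rfl⟩, ⟨g * g₁, rfl⟩, ⟨g * g₂, rfl⟩⟩
  have hfactors : ∀ g h, F g = F h → ρ g p = ρ h p := by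
    intro g h hgh
    simp only [hF, Prod.mk.injEq, _root_.map_mul, BoundaryAtInfinity.map_mul] at hgh
    have key : ∀ {z}, map (ρ g) z = map (ρ h) z → map (ρ (h⁻¹ * g)) z = z := by
      intro z hz
      rw [_root_.map_mul, BoundaryAtInfinity.map_mul, hz, map_inv, map_inv_map]
    have := hp (ρ (h⁻¹ * g)) (key hgh.1) (key hgh.2.1) (key hgh.2.2)
    rw [_root_.map_mul, map_inv] at this
    calc ρ g p = ρ h ((ρ h)⁻¹ (ρ g p)) := ((ρ h).apply_symm_apply _).symm
      _ = ρ h p := congrArg (ρ h) this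
  obtain ⟨f, hf⟩ : ∃ f, (fun g => ρ g p) = f ∘ F := by
    have : Function.FactorsThrough (fun g => ρ g p) F := fun g h => hfactors g h
    exact ⟨_, (this.extend_comp fun _ => p).symm⟩
  rw [hf, Set.range_comp]
  exact hFfin.image f

theorem fixesPoint_or_preservesGeodesic (hX : IsCATNegOne X) (ρ : G →* (X ≃ᵢ X))
    (h : ¬ NonElementary ρ) : FixesPoint ρ ∨ PreservesGeodesic ρ := by
  simp only [NonElementary, not_forall, not_not] at h
  obtain ⟨p | ξ, hfin⟩ := h
  · have hfin' : (Set.range fun g => ρ g p).Finite := by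
      refine Set.Finite.of_finite_image (f := Sum.inl (β := BoundaryAtInfinity X)) ?_
        Sum.inl_injective.injOn
      rwa [← Set.range_comp]
    obtain ⟨q, hq⟩ := hX.exists_fixed_of_finite_orbit ρ hfin'
    exact Or.inl ⟨Sum.inl q, fun g => congrArg Sum.inl (hq g)⟩
  · have hfin' : (Set.range fun g => map (ρ g) ξ).Finite := by
      refine Set.Finite.of_finite_image (f := Sum.inr (α := X)) ?_ Sum.inr_injective.injOn
      rwa [← Set.range_comp]
    by_cases hfix : ∀ g, map (ρ g) ξ = ξ
    · exact Or.inl ⟨Sum.inr ξ, fun g => congrArg Sum.inr (hfix g)⟩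
    push Not at hfix
    obtain ⟨g₁, hg₁⟩ := hfix
    by_cases hpair : ∀ g, map (ρ g) ξ = ξ ∨ map (ρ g) ξ = map (ρ g₁) ξ
    · right
      refine hX.preservesGeodesic_of_pair ρ hg₁.symm fun g => ?_
      have h₁ := hpair g
      have h₂ := hpair (g * g₁)
      rw [_root_.map_mul, BoundaryAtInfinity.map_mul] at h₂
      -- by injectivity, `g` cannot send both points to the same one
      have h₃ := (map_injective (ρ g)).ne hg₁
      grind
    · push Not at hpair
      obtain ⟨g₂, hg₂, hg₁₂⟩ := hpair
      obtain ⟨q, hq⟩ := hX.exists_fixed_of_finite_boundary_orbit ρ hfin' hg₁.symm hg₂.symm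
        hg₁₂.symm
      exact Or.inl ⟨Sum.inl q, fun g => congrArg Sum.inl (hq g)⟩

end IsCATNegOne

/-! ### Elementary representations -/

theorem FixesPoint.not_nonElementary {G X : Type*} [Group G] [MetricSpace X] {ρ : G →* (X ≃ᵢ X)}
    (h : FixesPoint ρ) : ¬ NonElementary ρ := by
  obtain ⟨z, hz⟩ := h
  exact fun hρ => hρ z ((Set.finite_singleton z).subset (by rintro _ ⟨g, rfl⟩; exact hz g))

theorem Isometry.eq_add_or_eq_sub {f : ℝ → ℝ} (hf : Isometry f) :
    (∀ t, f t = f 0 + t) ∨ ∀ t, f t = f 0 - t := by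
  have hsq : ∀ s t, (f s - f t) ^ 2 = (s - t) ^ 2 := fun s t => by
    rw [← sq_abs, ← Real.dist_eq, hf.dist_eq, Real.dist_eq, sq_abs]
  have h₁ : f 1 - f 0 = 1 ∨ f 1 - f 0 = -1 := by
    rw [← sq_eq_one_iff]
    simpa using hsq 1 0
  rcases h₁ with h | h
  -- the values at `0` and `1` determine the value at `t`
  · exact Or.inl fun t => by nlinarith [hsq t 0, hsq t 1]
  · exact Or.inr fun t => by nlinarith [hsq t 0, hsq t 1]

/-- An invariant geodesic yields an orbit with at most two points, the ends of the geodesic. -/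
theorem PreservesGeodesic.not_nonElementary {G X : Type*} [Group G] [MetricSpace X]
    {ρ : G →* (X ≃ᵢ X)} (h : PreservesGeodesic ρ) : ¬ NonElementary ρ := by
  obtain ⟨γ, hγ, hinv⟩ := h
  set σ : GeodesicRay X := ⟨fun t => γ t, hγ.comp isometry_subtype_coe⟩
  set τ : GeodesicRay X := ⟨fun t => γ (-t),
    hγ.comp ((IsometryEquiv.neg ℝ).isometry.comp isometry_subtype_coe)⟩
  refine fun hρ => hρ (Sum.inr (Quotient.mk (GeodesicRay.setoid X) σ))
    ((Set.toFinite {Sum.inr (Quotient.mk (GeodesicRay.setoid X) σ),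
      Sum.inr (Quotient.mk (GeodesicRay.setoid X) τ)}).subset ?_)
  rintro _ ⟨g, rfl⟩
  have hex : ∀ t, ∃ s, γ s = ρ g (γ t) := fun t => by
    have : ρ g (γ t) ∈ Set.range γ := hinv g ▸ ⟨γ t, ⟨t, rfl⟩, rfl⟩
    exact this
  choose f hf using hex
  have hfiso : Isometry f := Isometry.of_dist_eq fun s t => by
    rw [← hγ.dist_eq, hf, hf, (ρ g).dist_eq, hγ.dist_eq]
  rcases hfiso.eq_add_or_eq_sub with h | h
  · refine Or.inl (congrArg Sum.inr (BoundaryAtInfinity.mk_eq_mk.2 ⟨|f 0|, fun t => ?_⟩))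
    change dist (ρ g (γ t)) (γ t) ≤ _
    rw [← hf, hγ.dist_eq, h t, Real.dist_eq, add_sub_cancel_right]
  · refine Or.inr (congrArg Sum.inr (BoundaryAtInfinity.mk_eq_mk.2 ⟨|f 0|, fun t => ?_⟩))
    change dist (ρ g (γ t)) (γ (-t)) ≤ _
    rw [← hf, hγ.dist_eq, h t, Real.dist_eq, sub_neg_eq_add, sub_add_cancel]

theorem mainTheorem6 {G : Type*} [Group G] [TopologicalSpace G] [IsTopologicalGroup G]
    {X : Type*} [MetricSpace X] [CompleteSpace X] (hX : IsCATNegOne X)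
    (ρ : G →* (X ≃ᵢ X)) (hρ : OrbitallyContinuous ρ) :
    NonElementary ρ ↔ ¬ FixesPoint ρ ∧ ¬ PreservesGeodesic ρ := by
  refine ⟨fun h => ⟨fun h' => h'.not_nonElementary h, fun h' => h'.not_nonElementary h⟩,
    fun ⟨h₁, h₂⟩ => ?_⟩
  by_contra h
  exact (hX.fixesPoint_or_preservesGeodesic ρ h).elim h₁ h₂
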